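/- **Proposition** ($B\mathbb{Z}/2 \simeq \mathbb{R}P^\infty$, $BS^1 \simeq \mathbb{C}P^\infty$). *Conventions.* Diffeological spaces are considered with the usual product, sub- and quotient diffeologies. Two smooth maps $f,g : X \to Y$ are smoothly homotopic if there is a smooth map $F : X \times \mathbb{R} \to Y$ with $F(x,0)=f(x)$ and $F(x,1)=g(x)$ for all $x \in X$. $X$ and $Y$ are smoothly homotopy equivalent if there are smooth maps $f : X \to Y$ and $g : Y \to X$ such that $g\circ f$ and $f \circ g$ are smoothly homotopic to the respective identity maps. For $\mathbb{K} = \mathbb{R}$ or $\mathbb{C}$, the direct sum $\oplus_\omega \mathbb{K}$ of countably many copies of $\mathbb{K}$ has the diffeology in which a function into it is a plot if and only if each of its components is smooth and, locally, all but finitely many components vanish identically. *The spaces $EG$ and $BG$.* Let $G$ be a diffeological group, i.e. a group with a diffeology for which multiplication and inversion are smooth. Let $$\Delta^\omega = \Big\{(t_0,t_1,\ldots) \in \oplus_\omega \mathbb{R} \;\Big|\; \sum_i t_i = 1,\ t_i \ge 0 \text{ for all } i\Big\}$$ with the sub-diffeology. $EG$ is the quotient of $\Delta^\omega \times \prod_\omega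 G$ by the equivalence relation for which $(t_i,g_i) \sim (t_i',g_i')$ if and only if $t_i = t_i'$ for all $i$ and $g_i = g_i'$ whenever $t_i = t_i' \ne 0$. The group $G$ acts on $EG$ on the right by $[t_i,g_i]\cdot g = [t_i, g_i g]$, and $BG$ is the orbit space $EG/G$ with the quotient diffeology. *The projective spaces.* Let $S^\infty$ be the set of elements of norm $1$ in $\oplus_\omega \mathbb{R}$, with the sub-diffeology. The discrete group $\mathbb{Z}/2 = \{\pm 1\}$ acts on it by multiplication, and $\mathbb{R}P^\infty$ is the orbit space with the quotient diffeology. Identifying $\oplus_\omega \mathbb{R}$ with $\oplus_\omega \mathbb{C}$, regard $S^\infty$ as the set of unit vectors in $\oplus_\omega \mathbb{C}$. The Lie group $S^1$, with its standard diffeology, acts on it by pointwise multiplication, and $\mathbb{C}P^\infty$ is the orbit space with the quotient diffeology. *Statement.* 1. $B\mathbb{Z}/2$ is smoothly homotopy equivalent to $\mathbb{R}P^\infty$. 2. $BS^1$ is smoothly homotopy equivalent to $\mathbb{C}P^\infty$. -/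

import Mathlib

open scoped ContDiff Topology
open Diffeology

noncomputable section

namespace SmoothClassifying

/-! ### Constructions with diffeological spaces

`DiffeologicalSpace X` records the plots `ℝⁿ → X` defined on the whole of `ℝⁿ`; the plots on an open
set are then the functions that are locally restrictions of global plots. -/

/-- Every neighbourhood of `x` receives a smooth map from `ℝⁿ` that is the identity near `x`. -/
theorem exists_smooth_eventually_id {n : ℕ} {u : Set (EuclideanSpace ℝ (Fin n))}
    (hu : IsOpen u) {x : EuclideanSpace ℝ (Fin n)} (hx : x ∈ u) :
    ∃ f : EuclideanSpace ℝ (Fin n) → EuclideanSpace ℝ (Fin n),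
      (∀ y, f y ∈ u) ∧ ContDiff ℝ ∞ f ∧ ∀ᶠ y in 𝓝 x, f y = y := by
  obtain ⟨ε, hε, hball⟩ := Metric.isOpen_iff.1 hu x hx
  let χ : ContDiffBump x := ⟨ε / 2, ε, by positivity, by linarith⟩
  refine ⟨fun y => x + χ y • (y - x), fun y => hball ?_, ?_, ?_⟩
  · rw [Metric.mem_ball, dist_eq_norm, add_sub_cancel_left, norm_smul, Real.norm_eq_abs,
      abs_of_nonneg χ.nonneg]
    by_cases hy : y ∈ Metric.ball x ε
    · have h1 : ‖y - x‖ < ε := by rwa [Metric.mem_ball, dist_eq_norm] at hy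
      have h2 := χ.le_one (x := y)
      have h3 := χ.nonneg (x := y)
      nlinarith [norm_nonneg (y - x)]
    · have : χ y = 0 := χ.zero_of_le_dist (by simpa [Metric.mem_ball] using hy)
      rw [this, zero_mul]; exact hε
  · exact contDiff_const.add (χ.contDiff.smul (contDiff_id.sub contDiff_const))
  · filter_upwards [Metric.closedBall_mem_nhds x (show 0 < ε / 2 by positivity)] with y hy
    rw [χ.one_of_mem_closedBall hy, one_smul, add_sub_cancel]

/-- The sub-diffeology on a subset. -/
instance {X : Type*} [DiffeologicalSpace X] (P : X → Prop) : DiffeologicalSpace (Subtype P) where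
  plots _ := {p | IsPlot fun x => (p x : X)}
  constant_plots _ := isPlot_const
  plot_reparam hp hf := isPlot_reparam hp hf
  locality h := DiffeologicalSpace.locality h

/-- The product diffeology on `X × Y`. -/
instance {X Y : Type*} [DiffeologicalSpace X] [DiffeologicalSpace Y] :
    DiffeologicalSpace (X × Y) where
  plots _ := {p | (IsPlot fun x => (p x).1) ∧ IsPlot fun x => (p x).2}
  constant_plots _ := ⟨isPlot_const, isPlot_const⟩
  plot_reparam hp hf := ⟨isPlot_reparam hp.1 hf, isPlot_reparam hp.2 hf⟩
  locality h :=
    ⟨DiffeologicalSpace.locality fun x =>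
      let ⟨u, hu, hx, hp⟩ := h x
      ⟨u, hu, hx, fun hf hf' => (hp hf hf').1⟩,
    DiffeologicalSpace.locality fun x =>
      let ⟨u, hu, hx, hp⟩ := h x
      ⟨u, hu, hx, fun hf hf' => (hp hf hf').2⟩⟩

/-- The product diffeology on an arbitrary product. -/
instance {ι : Type*} {X : ι → Type*} [∀ i, DiffeologicalSpace (X i)] :
    DiffeologicalSpace (∀ i, X i) where
  plots _ := {p | ∀ i, IsPlot fun x => p x i}
  constant_plots _ _ := isPlot_const
  plot_reparam hp hf i := isPlot_reparam (hp i) hf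
  locality h i := DiffeologicalSpace.locality fun x =>
    let ⟨u, hu, hx, hp⟩ := h x
    ⟨u, hu, hx, fun hf hf' => hp hf hf' i⟩

/-- The quotient diffeology: the plots are the functions that locally lift to plots of `X`. -/
instance {X : Type*} [DiffeologicalSpace X] (s : Setoid X) : DiffeologicalSpace (Quotient s) where
  plots n := {p | ∀ x, ∃ q : EuclideanSpace ℝ (Fin n) → X,
    IsPlot q ∧ ∀ᶠ y in 𝓝 x, p y = Quotient.mk s (q y)}
  constant_plots a _ := by
    obtain ⟨a, rfl⟩ := Quotient.exists_rep a
    exact ⟨fun _ => a, isPlot_const, Filter.Eventually.of_forall fun _ => rfl⟩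
  plot_reparam {n m p f} hp hf x := by
    obtain ⟨q, hq, h⟩ := hp (f x)
    exact ⟨q ∘ f, isPlot_reparam hq hf, hf.continuous.continuousAt.eventually h⟩
  locality {n p} h x := by
    obtain ⟨u, hu, hx, hp⟩ := h x
    obtain ⟨f, hfu, hf, hfx⟩ := exists_smooth_eventually_id hu hx
    obtain ⟨q, hq, h⟩ := hp hfu hf x
    refine ⟨q, hq, ?_⟩
    filter_upwards [h, hfx] with y h1 h2
    rw [← h1, Function.comp_apply, h2]

/-- The direct sum `⊕_ω V` of countably many copies of a diffeological vector space `V`: a function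
into it is a plot iff its components are plots and, locally, all but finitely many components vanish
identically. -/
instance {V : Type*} [Zero V] [DiffeologicalSpace V] : DiffeologicalSpace (ℕ →₀ V) where
  plots _ := {p | (∀ i, IsPlot fun x => p x i) ∧
    ∀ x, ∃ N : ℕ, ∀ᶠ y in 𝓝 x, ∀ i, N < i → p y i = 0}
  constant_plots a := by
    refine ⟨fun _ => isPlot_const, fun _ => ⟨a.support.sup id, Filter.Eventually.of_forall ?_⟩⟩
    intro _ i hi
    by_contra h
    exact absurd (Finset.le_sup (f := id) (Finsupp.mem_support_iff.2 h)) (not_le.2 hi)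
  plot_reparam {n m p f} hp hf := by
    refine ⟨fun i => isPlot_reparam (hp.1 i) hf, fun x => ?_⟩
    obtain ⟨N, hN⟩ := hp.2 (f x)
    exact ⟨N, hf.continuous.continuousAt.eventually hN⟩
  locality {n p} h := by
    refine ⟨fun i => DiffeologicalSpace.locality fun x => ?_, fun x => ?_⟩
    · obtain ⟨u, hu, hx, hp⟩ := h x
      exact ⟨u, hu, hx, fun hf hf' => (hp hf hf').1 i⟩
    · obtain ⟨u, hu, hx, hp⟩ := h x
      obtain ⟨f, hfu, hf, hfx⟩ := exists_smooth_eventually_id hu hx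
      obtain ⟨N, hN⟩ := (hp hfu hf).2 x
      refine ⟨N, ?_⟩
      filter_upwards [hN, hfx] with y h1 h2 i hi
      rw [← h1 i hi, Function.comp_apply, h2]

/-- The standard diffeology on `ℂ`. -/
instance : DiffeologicalSpace ℂ := NormedSpace.toDiffeology ℂ

/-! ### Smooth homotopy -/

/-- Smooth maps `f g : X → Y` are smoothly homotopic. -/
def SmoothlyHomotopic {X Y : Type*} [DiffeologicalSpace X] [DiffeologicalSpace Y]
    (f g : X → Y) : Prop :=
  ∃ F : X × ℝ → Y, DSmooth F ∧ (∀ x, F (x, 0) = f x) ∧ ∀ x, F (x, 1) = g x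

/-- `X` and `Y` are smoothly homotopy equivalent. -/
def SmoothlyHomotopyEquivalent (X Y : Type*) [DiffeologicalSpace X] [DiffeologicalSpace Y] :
    Prop :=
  ∃ (f : X → Y) (g : Y → X), DSmooth f ∧ DSmooth g ∧
    SmoothlyHomotopic (g ∘ f) id ∧ SmoothlyHomotopic (f ∘ g) id

/-! ### Diffeological groups and the spaces `EG` and `BG` -/

/-- A diffeological group: multiplication and inversion are smooth. -/
class DiffeologicalGroup (G : Type*) [Group G] [DiffeologicalSpace G] : Prop where
  smooth_mul : DSmooth fun p : G × G => p.1 * p.2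
  smooth_inv : DSmooth fun g : G => g⁻¹

/-- The infinite simplex `Δ^ω`, with the sub-diffeology of `⊕_ω ℝ`. -/
abbrev InfiniteSimplex : Type :=
  {t : ℕ →₀ ℝ // (t.sum fun _ a => a) = 1 ∧ ∀ i, 0 ≤ t i}

section EG

variable (G : Type*) [Group G] [DiffeologicalSpace G] [DiffeologicalGroup G]

/-- `(t_i, g_i) ∼ (t_i', g_i')` iff `t_i = t_i'` for all `i`, and `g_i = g_i'` whenever
`t_i = t_i' ≠ 0`. -/
def EG.setoid : Setoid (InfiniteSimplex × (ℕ → G)) where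
  r a b := (∀ i, a.1.1 i = b.1.1 i) ∧ ∀ i, a.1.1 i ≠ 0 → a.2 i = b.2 i
  iseqv :=
    { refl := fun _ => ⟨fun _ => rfl, fun _ _ => rfl⟩
      symm := fun h => ⟨fun i => (h.1 i).symm, fun i hi => (h.2 i (by rwa [h.1 i])).symm⟩
      trans := fun h k => ⟨fun i => (h.1 i).trans (k.1 i),
        fun i hi => (h.2 i hi).trans (k.2 i (by rwa [← h.1 i]))⟩ }

/-- The total space `EG`, with the quotient diffeology. -/
def EG : Type _ := Quotient (EG.setoid G)

instance : DiffeologicalSpace (EG G) := inferInstanceAs (DiffeologicalSpace (Quotient _))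

/-- The right action `[t_i, g_i] · g = [t_i, g_i g]` of `G` on `EG`; a right action of `G` is an
action of the opposite group. -/
instance : MulAction Gᵐᵒᵖ (EG G) where
  smul g := Quotient.map (fun a => (a.1, fun i => a.2 i * g.unop))
    fun _ _ h => ⟨h.1, fun i hi => congrArg (· * g.unop) (h.2 i hi)⟩
  one_smul x := by
    induction x using Quotient.inductionOn with
    | h a => exact congrArg (Quotient.mk _) (Prod.ext rfl (funext fun i => mul_one (a.2 i)))
  mul_smul g h x := by
    induction x using Quotient.inductionOn with
    | h a =>
      exact congrArg (Quotient.mk _)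
        (Prod.ext rfl (funext fun i => (mul_assoc (a.2 i) h.unop g.unop).symm))

/-- The classifying space `BG`: the orbit space of `EG`, with the quotient diffeology. -/
def BG : Type _ := Quotient (MulAction.orbitRel Gᵐᵒᵖ (EG G))

instance : DiffeologicalSpace (BG G) := inferInstanceAs (DiffeologicalSpace (Quotient _))

end EG

/-! ### The groups `ℤ/2` and `S¹` -/

/-- The discrete diffeology on the multiplicative group `{±1} = ℤ/2`: the plots are the locally
constant functions. -/
instance : DiffeologicalSpace ℤˣ where
  plots _ := {p | IsLocallyConstant p}
  constant_plots a := IsLocallyConstant.const a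
  plot_reparam hp hf := hp.comp_continuous hf.continuous
  locality {n p} h := (IsLocallyConstant.iff_eventually_eq p).2 fun x => by
    obtain ⟨u, hu, hx, hp⟩ := h x
    obtain ⟨f, hfu, hf, hfx⟩ := exists_smooth_eventually_id hu hx
    filter_upwards [(hp hfu hf).eventually_eq x, hfx] with y h1 h2
    simpa only [Function.comp_apply, h2, hfx.self_of_nhds] using h1

instance : DiffeologicalGroup ℤˣ where
  smooth_mul _ _ hp := IsLocallyConstant.mul hp.1 hp.2
  smooth_inv _ _ hp := IsLocallyConstant.inv hp

/-- The standard diffeology on the Lie group `S¹`: as `S¹` is an embedded submanifold of `ℂ`, the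
plots are the functions that are smooth as functions to `ℂ`. -/
instance : DiffeologicalSpace Circle where
  plots n := {p | IsPlot fun x : EuclideanSpace ℝ (Fin n) => (p x : ℂ)}
  constant_plots a := show IsPlot fun _ => (a : ℂ) from isPlot_const
  plot_reparam {_ _ p _} hp hf := isPlot_reparam (p := fun x => (p x : ℂ)) hp hf
  locality {_ p} h := DiffeologicalSpace.locality (p := fun x => (p x : ℂ)) h

theorem isPlot_circle_iff {n : ℕ} {p : EuclideanSpace ℝ (Fin n) → Circle} :
    IsPlot p ↔ ContDiff ℝ ∞ fun x => (p x : ℂ) :=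
  Iff.rfl

instance : DiffeologicalGroup Circle where
  smooth_mul _ p hp := by
    have h1 := isPlot_circle_iff.1 hp.1
    have h2 := isPlot_circle_iff.1 hp.2
    exact isPlot_circle_iff.2 (by simpa using h1.mul h2)
  smooth_inv _ p hp := by
    have h1 := isPlot_circle_iff.1 hp
    have h2 : ContDiff ℝ ∞ fun x => (Complex.conjCLE (p x : ℂ)) := Complex.conjCLE.contDiff.comp h1
    have h3 : (fun x => (((p x)⁻¹ : Circle) : ℂ)) = fun x => Complex.conjCLE (p x : ℂ) :=
      funext fun x => Circle.coe_inv_eq_conj (p x)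
    exact isPlot_circle_iff.2 (h3 ▸ h2)

/-! ### The infinite sphere and the infinite projective spaces -/

/-- The unit sphere of `⊕_ω 𝕜` (for `𝕜 = ℝ` or `ℂ`), with the sub-diffeology. -/
abbrev InfiniteSphere (𝕜 : Type) [RCLike 𝕜] : Type :=
  {x : ℕ →₀ 𝕜 // (x.sum fun _ a => ‖a‖ ^ 2) = 1}

/-- The action of `ℤ/2 = {±1}` on the unit sphere of `⊕_ω ℝ` by multiplication. -/
instance : MulAction ℤˣ (InfiniteSphere ℝ) where
  smul g x := ⟨g • x.1, by
    rw [Finsupp.sum_smul_index' (by simp)]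
    rcases Int.units_eq_one_or g with rfl | rfl <;> simpa using x.2⟩
  one_smul x := Subtype.ext (one_smul _ x.1)
  mul_smul g h x := Subtype.ext (mul_smul g h x.1)

/-- The action of `S¹` on the unit sphere of `⊕_ω ℂ` by pointwise multiplication. -/
instance : MulAction Circle (InfiniteSphere ℂ) where
  smul g x := ⟨g • x.1, by
    have h : (g • x.1).support = x.1.support := by
      ext i; simp [Circle.smul_def]
    simpa [Finsupp.sum, h, Circle.smul_def, Circle.norm_coe] using x.2⟩
  one_smul x := Subtype.ext (one_smul _ x.1)
  mul_smul g h x := Subtype.ext (mul_smul g h x.1)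

/-- `ℝP^∞`, the orbit space of the infinite sphere by `ℤ/2`, with the quotient diffeology. -/
def InfiniteRealProjectiveSpace : Type := Quotient (MulAction.orbitRel ℤˣ (InfiniteSphere ℝ))

instance : DiffeologicalSpace InfiniteRealProjectiveSpace :=
  inferInstanceAs (DiffeologicalSpace (Quotient _))

/-- `ℂP^∞`, the orbit space of the infinite sphere by `S¹`, with the quotient diffeology. -/
def InfiniteComplexProjectiveSpace : Type := Quotient (MulAction.orbitRel Circle (InfiniteSphere ℂ))

instance : DiffeologicalSpace InfiniteComplexProjectiveSpace :=
  inferInstanceAs (DiffeologicalSpace (Quotient _))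

end SmoothClassifying

end

open scoped ContDiff Topology
open Diffeology

noncomputable section

namespace SmoothClassifying

/-! ### Local tests for plots, and smooth maps out of quotients -/

section Generalities

variable {n : ℕ}

/-! Both statements are one: `G` is the group of scalars of norm `1` in `𝕜` (`UnitScalars`), and
`BG` is compared with the sphere modulo `G`. From `BG`, send `[t, g]` to the class of the normalized
vector `(t_i g_i)`. Backwards, a unit vector `x` should give the phases `x_i / ‖x_i‖` with suitable
weights. The weights `‖x_i‖ ^ 2` would not do: a plot of `BG` must lift locally to smooth `g_i`, and
the phase has in general no smooth extension across `x_i = 0`.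

The remedy is a smooth partition of unity whose `i`-th function vanishes in a neighbourhood of any
point with `x_i = 0` (`eventually_sphereToSimplex_apply_eq_zero`). There `g_i` is irrelevant and can
be replaced by a constant, so smooth lifts exist locally (`exists_isPlot_eventually_coords`).

Both composites keep the phases and change only the moduli, possibly killing some coordinates.
Renormalized straight segments therefore join them to the identities: on the sphere in
`sphereHomotopy`, and on `BG` by moving the weights with `g` fixed in `simplexHomotopy`. The
segments avoid `0` because at some index both ends are positive multiples of the same scalar. All
constructions respect `G`, so they descend to the orbit spaces. -/

theorem isPlot_of_eventuallyEq {X : Type*} [DiffeologicalSpace X]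
    {p : EuclideanSpace ℝ (Fin n) → X}
    (h : ∀ x, ∃ q : EuclideanSpace ℝ (Fin n) → X, IsPlot q ∧ ∀ᶠ y in 𝓝 x, p y = q y) :
    IsPlot p := by
  refine DiffeologicalSpace.locality fun x => ?_
  obtain ⟨q, hq, hpq⟩ := h x
  obtain ⟨u, hu, hu', hxu⟩ := eventually_nhds_iff.1 hpq
  refine ⟨u, hu', hxu, fun {m f} hf hf' => ?_⟩
  rw [show p ∘ f = q ∘ f from funext fun y => hu _ (hf y)]
  exact isPlot_reparam hq hf'

theorem dSmooth_quotientMk {X : Type*} [DiffeologicalSpace X] (s : Setoid X) :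
    DSmooth (Quotient.mk s) :=
  fun _ p hp _ => ⟨p, hp, Filter.Eventually.of_forall fun _ => rfl⟩

theorem dSmooth_of_comp_quotientMk {X Y : Type*} [DiffeologicalSpace X] [DiffeologicalSpace Y]
    {s : Setoid X} {f : Quotient s → Y} (hf : DSmooth fun x => f (Quotient.mk s x)) :
    DSmooth f := fun _ p hp => isPlot_of_eventuallyEq fun x => by
  obtain ⟨q, hq, h⟩ := hp x
  exact ⟨_, hf _ q hq, h.mono fun y hy => congrArg f hy⟩

/-- Needed for homotopies, whose source is a quotient times `ℝ`: only the first component has to be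
lifted. -/
theorem dSmooth_of_comp_quotientMk_prod {X Y Z : Type*} [DiffeologicalSpace X]
    [DiffeologicalSpace Y] [DiffeologicalSpace Z]
    {s : Setoid X} {f : Quotient s × Z → Y}
    (hf : DSmooth fun x : X × Z => f (Quotient.mk s x.1, x.2)) :
    DSmooth f := fun _ p hp => isPlot_of_eventuallyEq fun x => by
  obtain ⟨q, hq, h⟩ := hp.1 x
  exact ⟨_, hf _ (fun y => (q y, (p y).2)) ⟨hq, hp.2⟩,
    h.mono fun y hy => congrArg f (Prod.ext hy rfl)⟩

end Generalities

/-! ### Plots of the direct sum -/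

section DirectSum

variable {n : ℕ} {V : Type*} [NormedAddCommGroup V] [NormedSpace ℝ V] [DiffeologicalSpace V]
  [IsContDiffCompatible V] {p q : EuclideanSpace ℝ (Fin n) → ℕ →₀ V}

theorem isPlot_finsupp_iff : IsPlot p ↔ (∀ i, ContDiff ℝ ∞ fun x => p x i) ∧
    ∀ x, ∃ N : ℕ, ∀ᶠ y in 𝓝 x, ∀ i, N < i → p y i = 0 :=
  and_congr (forall_congr' fun _ => IsContDiffCompatible.isPlot_iff) Iff.rfl

theorem isPlot_finsupp_add (hp : IsPlot p) (hq : IsPlot q) : IsPlot fun x => p x + q x := by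
  rw [isPlot_finsupp_iff] at *
  refine ⟨fun i => (hp.1 i).add (hq.1 i), fun x => ?_⟩
  obtain ⟨N, hN⟩ := hp.2 x
  obtain ⟨M, hM⟩ := hq.2 x
  refine ⟨max N M, ?_⟩
  filter_upwards [hN, hM] with y h1 h2 i hi
  simp [h1 i (lt_of_le_of_lt (le_max_left _ _) hi), h2 i (lt_of_le_of_lt (le_max_right _ _) hi)]

theorem isPlot_finsupp_smul {c : EuclideanSpace ℝ (Fin n) → ℝ} (hc : ContDiff ℝ ∞ c)
    (hp : IsPlot p) : IsPlot fun x => c x • p x := by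
  rw [isPlot_finsupp_iff] at *
  refine ⟨fun i => hc.smul (hp.1 i), fun x => ?_⟩
  obtain ⟨N, hN⟩ := hp.2 x
  exact ⟨N, hN.mono fun y h i hi => by simp [h i hi]⟩

theorem contDiff_finsupp_sum (hp : IsPlot p) {φ : V → ℝ} (hφ : ContDiff ℝ ∞ φ) (h0 : φ 0 = 0) :
    ContDiff ℝ ∞ fun x => (p x).sum fun _ a => φ a := by
  rw [isPlot_finsupp_iff] at hp
  refine contDiff_iff_contDiffAt.2 fun x => ?_
  obtain ⟨N, hN⟩ := hp.2 x
  -- The support varies with `x`, but near a given point it stays in `range (N + 1)`, and `φ 0 = 0`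
  -- makes the extra terms harmless.
  have h : ContDiff ℝ ∞ fun x => ∑ i ∈ Finset.range (N + 1), φ (p x i) :=
    ContDiff.sum fun i _ => hφ.comp (hp.1 i)
  refine h.contDiffAt.congr_of_eventuallyEq (hN.mono fun y hy => ?_)
  refine Finsupp.sum_of_support_subset _ (fun i hi => ?_) _ fun _ _ => h0
  rw [Finset.mem_range]
  by_contra hi'
  exact Finsupp.mem_support_iff.1 hi (hy i (by omega))

end DirectSum

/-! ### Normalization -/

section Simplex

variable {n : ℕ}

theorem finsupp_sum_pos {w : ℕ →₀ ℝ} (h0 : ∀ i, 0 ≤ w i) (hw : w ≠ 0) :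
    0 < w.sum fun _ a => a := by
  obtain ⟨i, hi⟩ := Finsupp.ne_iff.1 hw
  exact Finset.sum_pos' (fun j _ => h0 j)
    ⟨i, Finsupp.mem_support_iff.2 hi, lt_of_le_of_ne (h0 i) (Ne.symm hi)⟩

/-- Rescale a nonzero family of nonnegative weights to a point of the simplex. -/
def toSimplex (w : ℕ →₀ ℝ) (h0 : ∀ i, 0 ≤ w i) (hw : w ≠ 0) : InfiniteSimplex :=
  ⟨(w.sum fun _ a => a)⁻¹ • w, by
    rw [Finsupp.sum_smul_index' (fun _ => rfl)]
    simp only [smul_eq_mul]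
    rw [← Finsupp.mul_sum, inv_mul_cancel₀ (finsupp_sum_pos h0 hw).ne'], fun i =>
    mul_nonneg (inv_nonneg.2 (finsupp_sum_pos h0 hw).le) (h0 i)⟩

theorem toSimplex_apply (w : ℕ →₀ ℝ) (h0 : ∀ i, 0 ≤ w i) (hw : w ≠ 0) (i : ℕ) :
    (toSimplex w h0 hw).1 i = (w.sum fun _ a => a)⁻¹ * w i := rfl

theorem toSimplex_apply_ne_zero_iff {w : ℕ →₀ ℝ} {h0 : ∀ i, 0 ≤ w i} {hw : w ≠ 0} {i : ℕ} :
    (toSimplex w h0 hw).1 i ≠ 0 ↔ w i ≠ 0 := by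
  simp [toSimplex_apply, (finsupp_sum_pos h0 hw).ne']

theorem toSimplex_self (t : InfiniteSimplex) (ht : t.1 ≠ 0) : toSimplex t.1 t.2.2 ht = t :=
  Subtype.ext (by simp [toSimplex, t.2.1])

theorem InfiniteSimplex.ne_zero (t : InfiniteSimplex) : t.1 ≠ 0 := fun h => by
  simpa [h] using t.2.1

theorem isPlot_toSimplex {p : EuclideanSpace ℝ (Fin n) → ℕ →₀ ℝ} (hp : IsPlot p)
    (h0 : ∀ x i, 0 ≤ p x i) (hne : ∀ x, p x ≠ 0) :
    IsPlot fun x => toSimplex (p x) (h0 x) (hne x) :=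
  isPlot_finsupp_smul ((contDiff_finsupp_sum hp contDiff_id rfl).inv
    fun x => (finsupp_sum_pos (h0 x) (hne x)).ne') hp

end Simplex

/-! ### Normalization to unit vectors -/

section Sphere

variable {n : ℕ} {𝕜 : Type} [RCLike 𝕜]

theorem finsupp_sum_norm_sq_pos {x : ℕ →₀ 𝕜} (hx : x ≠ 0) :
    0 < x.sum fun _ a => ‖a‖ ^ 2 := by
  obtain ⟨i, hi⟩ := Finsupp.ne_iff.1 hx
  exact Finset.sum_pos' (fun j _ => by positivity)
    ⟨i, Finsupp.mem_support_iff.2 hi, pow_pos (norm_pos_iff.2 hi) 2⟩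

/-- Rescale a nonzero vector to a unit vector. -/
def toSphere (x : ℕ →₀ 𝕜) (hx : x ≠ 0) : InfiniteSphere 𝕜 :=
  ⟨(√(x.sum fun _ a => ‖a‖ ^ 2))⁻¹ • x, by
    have h := finsupp_sum_norm_sq_pos hx
    rw [Finsupp.sum_smul_index' (fun _ => by simp)]
    simp only [norm_smul, mul_pow]
    rw [← Finsupp.mul_sum, norm_inv, inv_pow, Real.norm_eq_abs, sq_abs, Real.sq_sqrt h.le,
      inv_mul_cancel₀ h.ne']⟩

theorem toSphere_apply (x : ℕ →₀ 𝕜) (hx : x ≠ 0) (i : ℕ) :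
    (toSphere x hx).1 i = (√(x.sum fun _ a => ‖a‖ ^ 2))⁻¹ • x i := rfl

theorem toSphere_self (x : InfiniteSphere 𝕜) (hx : x.1 ≠ 0) : toSphere x.1 hx = x :=
  Subtype.ext (by simp [toSphere, x.2])

theorem InfiniteSphere.ne_zero (x : InfiniteSphere 𝕜) : x.1 ≠ 0 := fun h => by
  simpa [h] using x.2

/-- Used with `k = 2` for the normalization and `k = 4` for the partition of unity: both depend on
the moduli alone, hence are `G`-invariant. -/
theorem finsupp_sum_norm_congr {x y : ℕ →₀ 𝕜} (h : ∀ i, ‖x i‖ = ‖y i‖) (k : ℕ) :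
    (x.sum fun _ a => ‖a‖ ^ k) = y.sum fun _ a => ‖a‖ ^ k := by
  have hs : x.support = y.support := by
    ext i
    rw [Finsupp.mem_support_iff, Finsupp.mem_support_iff, ← norm_ne_zero_iff, h,
      norm_ne_zero_iff]
  simp only [Finsupp.sum, hs, h]

variable [DiffeologicalSpace 𝕜] [IsContDiffCompatible 𝕜]

theorem isPlot_toSphere {p : EuclideanSpace ℝ (Fin n) → ℕ →₀ 𝕜} (hp : IsPlot p)
    (hne : ∀ x, p x ≠ 0) : IsPlot fun x => toSphere (p x) (hne x) :=
  have h := contDiff_finsupp_sum hp (φ := fun a : 𝕜 => ‖a‖ ^ 2) (contDiff_norm_sq ℝ) (by simp)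
  isPlot_finsupp_smul ((h.sqrt fun x => (finsupp_sum_norm_sq_pos (hne x)).ne').inv
    fun x => (Real.sqrt_pos.2 (finsupp_sum_norm_sq_pos (hne x))).ne') hp

end Sphere

/-! ### A partition of unity on the sphere

The `i`-th function vanishes near the vectors with vanishing `i`-th coordinate. -/

section Weights

variable {𝕜 : Type} [RCLike 𝕜]

/-- The amount by which `‖x i‖ ^ 2` exceeds half of `∑ j, ‖x j‖ ^ 4`. -/
def excess (x : ℕ →₀ 𝕜) (i : ℕ) : ℝ := ‖x i‖ ^ 2 - (x.sum fun _ a => ‖a‖ ^ 4) / 2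

theorem finsupp_sum_norm_pow_four_pos {x : ℕ →₀ 𝕜} (hx : x ≠ 0) :
    0 < x.sum fun _ a => ‖a‖ ^ 4 := by
  obtain ⟨i, hi⟩ := Finsupp.ne_iff.1 hx
  exact Finset.sum_pos' (fun j _ => by positivity)
    ⟨i, Finsupp.mem_support_iff.2 hi, pow_pos (norm_pos_iff.2 hi) 4⟩

theorem excess_neg {x : ℕ →₀ 𝕜} (hx : x ≠ 0) {i : ℕ} (hi : x i = 0) : excess x i < 0 := by
  have := finsupp_sum_norm_pow_four_pos hx
  simp only [excess, hi, norm_zero]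
  linarith

/-- As `∑ ‖x j‖ ^ 2 = 1`, the sum `∑ ‖x j‖ ^ 4` is a weighted mean of the numbers `‖x j‖ ^ 2`. Some
`‖x i‖ ^ 2` is at least this positive mean, so it exceeds half of it. The mean is a smooth
substitute for the maximum. -/
theorem exists_excess_pos (x : InfiniteSphere 𝕜) : ∃ i, 0 < excess x.1 i := by
  by_contra! h
  have hM := finsupp_sum_norm_pow_four_pos x.ne_zero
  have h1 : (x.1.sum fun _ a => ‖a‖ ^ 4) ≤
      x.1.sum fun _ a => (x.1.sum fun _ a => ‖a‖ ^ 4) / 2 * ‖a‖ ^ 2 := by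
    refine Finset.sum_le_sum fun i _ => ?_
    have := h i
    rw [excess, sub_nonpos] at this
    calc ‖x.1 i‖ ^ 4 = ‖x.1 i‖ ^ 2 * ‖x.1 i‖ ^ 2 := by ring
      _ ≤ _ := mul_le_mul_of_nonneg_right this (by positivity)
  rw [← Finsupp.mul_sum, x.2] at h1
  linarith

/-- The unnormalized partition of unity. -/
def weight (x : ℕ →₀ 𝕜) : ℕ →₀ ℝ :=
  Finsupp.onFinset x.support (fun i => expNegInvGlue (excess x i)) fun i hi => by
    by_cases hx : x = 0
    · simp [hx, excess] at hi
    · exact Finsupp.mem_support_iff.2 fun h =>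
        hi (expNegInvGlue.zero_of_nonpos (excess_neg hx h).le)

theorem weight_apply (x : ℕ →₀ 𝕜) (i : ℕ) : weight x i = expNegInvGlue (excess x i) := rfl

theorem weight_nonneg (x : ℕ →₀ 𝕜) (i : ℕ) : 0 ≤ weight x i := expNegInvGlue.nonneg _

theorem weight_ne_zero (x : InfiniteSphere 𝕜) : weight x.1 ≠ 0 := by
  obtain ⟨i, hi⟩ := exists_excess_pos x
  exact Finsupp.ne_iff.2 ⟨i, (expNegInvGlue.pos_of_pos hi).ne'⟩

theorem weight_apply_of_eq_zero {x : ℕ →₀ 𝕜} {i : ℕ} (hi : x i = 0) : weight x i = 0 := by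
  by_contra h
  exact Finsupp.mem_support_iff.1 (Finsupp.support_onFinset_subset
    (Finsupp.mem_support_iff.2 h)) hi

theorem weight_congr {x y : ℕ →₀ 𝕜} (h : ∀ i, ‖x i‖ = ‖y i‖) : weight x = weight y := by
  ext i
  rw [weight_apply, weight_apply, excess, excess, h, finsupp_sum_norm_congr h]

/-- The partition of unity, as a map to the simplex. -/
def sphereToSimplex (x : InfiniteSphere 𝕜) : InfiniteSimplex :=
  toSimplex (weight x.1) (weight_nonneg x.1) (weight_ne_zero x)

theorem sphereToSimplex_congr {x y : InfiniteSphere 𝕜} (h : ∀ i, ‖x.1 i‖ = ‖y.1 i‖) :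
    sphereToSimplex x = sphereToSimplex y := by
  simp only [sphereToSimplex, weight_congr h]

theorem sphereToSimplex_apply_of_eq_zero {x : InfiniteSphere 𝕜} {i : ℕ} (hi : x.1 i = 0) :
    (sphereToSimplex x).1 i = 0 := by
  by_contra h
  exact toSimplex_apply_ne_zero_iff.1 h (weight_apply_of_eq_zero hi)

end Weights

/-! ### Smoothness of the partition of unity -/

section WeightsSmooth

variable {n : ℕ} {𝕜 : Type} [RCLike 𝕜] [DiffeologicalSpace 𝕜] [IsContDiffCompatible 𝕜]
  {p : EuclideanSpace ℝ (Fin n) → ℕ →₀ 𝕜}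

theorem contDiff_excess (hp : IsPlot p) (i : ℕ) : ContDiff ℝ ∞ fun x => excess (p x) i := by
  have h : ContDiff ℝ ∞ fun a : 𝕜 => ‖a‖ ^ 4 := by
    have h := (contDiff_norm_sq ℝ (E := 𝕜) (n := ∞)).pow 2
    simpa only [← pow_mul] using h
  exact (((isPlot_finsupp_iff.1 hp).1 i).norm_sq ℝ).sub
    ((contDiff_finsupp_sum hp h (by simp)).div_const 2)

theorem isPlot_weight (hp : IsPlot p) : IsPlot fun x => weight (p x) := by
  refine isPlot_finsupp_iff.2
    ⟨fun i => expNegInvGlue.contDiff.comp (contDiff_excess hp i), fun x => ?_⟩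
  obtain ⟨N, hN⟩ := (isPlot_finsupp_iff.1 hp).2 x
  exact ⟨N, hN.mono fun y h i hi => weight_apply_of_eq_zero (h i hi)⟩

theorem isPlot_sphereToSimplex {p : EuclideanSpace ℝ (Fin n) → InfiniteSphere 𝕜}
    (hp : IsPlot p) : IsPlot fun x => sphereToSimplex (p x) :=
  isPlot_toSimplex (isPlot_weight (p := fun x => (p x).1) hp) _ _

/-- The excess is strictly negative where `x i = 0`, hence nearby by continuity, and `expNegInvGlue`
vanishes on negative numbers. -/
theorem eventually_sphereToSimplex_apply_eq_zero
    {p : EuclideanSpace ℝ (Fin n) → InfiniteSphere 𝕜}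
    (hp : IsPlot p) {x : EuclideanSpace ℝ (Fin n)} {i : ℕ} (hi : (p x).1 i = 0) :
    ∀ᶠ y in 𝓝 x, (sphereToSimplex (p y)).1 i = 0 := by
  have h := (contDiff_excess (p := fun x => (p x).1) hp i).continuous.continuousAt (x := x)
  filter_upwards [h.eventually_lt_const (excess_neg (p x).ne_zero hi)] with y hy
  by_contra h
  exact toSimplex_apply_ne_zero_iff.1 h (expNegInvGlue.zero_of_nonpos hy.le)

end WeightsSmooth

/-! ### Maps out of `BG` -/

section ClassifyingSpace

variable {G : Type} [Group G]

/-- The point of `BG` with given coordinates. -/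
def BG.mk (a : InfiniteSimplex × (ℕ → G)) : BG G :=
  Quotient.mk (MulAction.orbitRel Gᵐᵒᵖ (EG G)) (Quotient.mk (EG.setoid G) a)

theorem BG.mk_eq_mk {t : InfiniteSimplex} {g h : ℕ → G} (H : ∀ i, t.1 i ≠ 0 → g i = h i) :
    BG.mk (t, g) = BG.mk (t, h) :=
  congrArg (Quotient.mk (MulAction.orbitRel Gᵐᵒᵖ (EG G)))
    (Quotient.sound (s := EG.setoid G) ⟨fun _ => rfl, H⟩)

theorem BG.mk_mul_right (t : InfiniteSimplex) (g : ℕ → G) (c : G) :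
    BG.mk (t, fun i => g i * c) = BG.mk (t, g) :=
  Quotient.sound (s := MulAction.orbitRel Gᵐᵒᵖ (EG G)) ⟨MulOpposite.op c, rfl⟩

/-- Functions on `BG` are functions of the coordinates that do not depend on the choices. -/
def BG.lift {Y : Type*} (φ : InfiniteSimplex × (ℕ → G) → Y)
    (h : ∀ t g g', (∀ i, t.1 i ≠ 0 → g i = g' i) → φ (t, g) = φ (t, g'))
    (hc : ∀ t g c, φ (t, fun i => g i * c) = φ (t, g)) : BG G → Y :=
  Quotient.lift (s := MulAction.orbitRel Gᵐᵒᵖ (EG G))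
    (Quotient.lift (s := EG.setoid G) φ fun a b hab => by
      obtain ⟨t, g⟩ := a
      obtain ⟨t', g'⟩ := b
      obtain rfl : t = t' := Subtype.ext (Finsupp.ext hab.1)
      exact h t g g' hab.2) fun x y hxy => by
    obtain ⟨c, rfl⟩ := hxy
    induction y using Quotient.inductionOn with
    | h a => exact hc a.1 a.2 c.unop

theorem BG.mk_surjective : Function.Surjective (BG.mk (G := G)) := fun x => by
  induction x using Quotient.inductionOn with
  | h x =>
    induction x using Quotient.inductionOn with
    | h a => exact ⟨a, rfl⟩

variable [DiffeologicalSpace G]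

theorem BG.dSmooth_mk : DSmooth (BG.mk (G := G)) :=
  (dSmooth_quotientMk (MulAction.orbitRel Gᵐᵒᵖ (EG G))).comp (dSmooth_quotientMk (EG.setoid G))

theorem BG.dSmooth_of_comp_mk {Y : Type*} [DiffeologicalSpace Y] {f : BG G → Y}
    (hf : DSmooth fun a => f (BG.mk a)) : DSmooth f :=
  dSmooth_of_comp_quotientMk (s := MulAction.orbitRel Gᵐᵒᵖ (EG G))
    (dSmooth_of_comp_quotientMk (s := EG.setoid G) hf)

theorem BG.dSmooth_of_comp_mk_prod {Y Z : Type*} [DiffeologicalSpace Y] [DiffeologicalSpace Z]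
    {f : BG G × Z → Y}
    (hf : DSmooth fun a : (InfiniteSimplex × (ℕ → G)) × Z => f (BG.mk a.1, a.2)) : DSmooth f :=
  dSmooth_of_comp_quotientMk_prod (s := MulAction.orbitRel Gᵐᵒᵖ (EG G))
    (dSmooth_of_comp_quotientMk_prod (s := EG.setoid G)
      (f := fun x : EG G × Z => f (Quotient.mk (MulAction.orbitRel Gᵐᵒᵖ (EG G)) x.1, x.2)) hf)

end ClassifyingSpace

/-! ### Groups of unit scalars -/

/-- An identification of `G` with the group of scalars of norm `1`, under which the diffeology is
the sub-diffeology and the action on the sphere is scalar multiplication. -/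
structure UnitScalars (G 𝕜 : Type) [RCLike 𝕜] [CommGroup G] [DiffeologicalSpace G]
    [MulAction G (InfiniteSphere 𝕜)] where
  toHom : G →* 𝕜
  norm_eq_one : ∀ g, ‖toHom g‖ = 1
  exists_eq : ∀ a : 𝕜, ‖a‖ = 1 → ∃ g, toHom g = a
  injective : Function.Injective toHom
  isPlot_iff : ∀ {n : ℕ} {p : EuclideanSpace ℝ (Fin n) → G},
    IsPlot p ↔ ContDiff ℝ ∞ fun x => toHom (p x)
  smul_apply : ∀ (g : G) (x : InfiniteSphere 𝕜) (i : ℕ), (g • x).1 i = toHom g * x.1 i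

namespace UnitScalars

section

variable {G 𝕜 : Type} [RCLike 𝕜] [CommGroup G] [DiffeologicalSpace G]
  [MulAction G (InfiniteSphere 𝕜)] (e : UnitScalars G 𝕜)

theorem norm_smul_apply (e : UnitScalars G 𝕜) (g : G) (x : InfiniteSphere 𝕜) (i : ℕ) : ‖(g • x).1 i‖ = ‖x.1 i‖ := by
  rw [e.smul_apply, norm_mul, e.norm_eq_one, one_mul]

theorem toHom_ne_zero (g : G) : e.toHom g ≠ 0 := norm_ne_zero_iff.1 (by simp [e.norm_eq_one])

/-- Nothing is asked at `a = 0`: a phase there only ever accompanies a zero weight. -/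
theorem exists_phase (a : 𝕜) : ∃ g, a ≠ 0 → e.toHom g = (‖a‖⁻¹ : ℝ) • a := by
  by_cases ha : a = 0
  · exact ⟨1, fun h => absurd ha h⟩
  · obtain ⟨g, hg⟩ := e.exists_eq ((‖a‖⁻¹ : ℝ) • a) (by
      rw [norm_smul, norm_inv, norm_norm, inv_mul_cancel₀ (norm_ne_zero_iff.2 ha)])
    exact ⟨g, fun _ => hg⟩

/-- The element of `G` corresponding to `a / ‖a‖`. -/
def phase (a : 𝕜) : G := (e.exists_phase a).choose

theorem toHom_phase {a : 𝕜} (ha : a ≠ 0) : e.toHom (e.phase a) = (‖a‖⁻¹ : ℝ) • a :=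
  (e.exists_phase a).choose_spec ha

theorem phase_mul (g : G) {a : 𝕜} (ha : a ≠ 0) :
    e.phase (e.toHom g * a) = e.phase a * g := e.injective <| by
  rw [e.toHom_phase (mul_ne_zero (e.toHom_ne_zero g) ha), map_mul, e.toHom_phase ha, norm_mul,
    e.norm_eq_one, one_mul, mul_comm _ (e.toHom g), mul_smul_comm]

theorem phase_smul_toHom (g : G) {r : ℝ} (hr : 0 < r) :
    e.phase (r • e.toHom g) = g := e.injective <| by
  rw [e.toHom_phase (smul_ne_zero hr.ne' (e.toHom_ne_zero g)), norm_smul, e.norm_eq_one,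
    Real.norm_of_nonneg hr.le, mul_one, smul_smul, inv_mul_cancel₀ hr.ne', one_smul]

/-- The vector with coordinates `t i * g i`. -/
def join (a : InfiniteSimplex × (ℕ → G)) : ℕ →₀ 𝕜 :=
  Finsupp.onFinset a.1.1.support (fun i => a.1.1 i • e.toHom (a.2 i)) fun i hi =>
    Finsupp.mem_support_iff.2 fun h => hi (by rw [h, zero_smul])

theorem join_apply (a : InfiniteSimplex × (ℕ → G)) (i : ℕ) :
    e.join a i = a.1.1 i • e.toHom (a.2 i) := rfl

theorem join_apply_ne_zero_iff {a : InfiniteSimplex × (ℕ → G)} {i : ℕ} :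
    e.join a i ≠ 0 ↔ a.1.1 i ≠ 0 := by
  simp [join_apply, e.toHom_ne_zero]

theorem join_ne_zero (a : InfiniteSimplex × (ℕ → G)) : e.join a ≠ 0 := by
  obtain ⟨i, hi⟩ := Finsupp.ne_iff.1 a.1.ne_zero
  exact Finsupp.ne_iff.2 ⟨i, e.join_apply_ne_zero_iff.2 hi⟩

theorem join_congr {t : InfiniteSimplex} {g h : ℕ → G} (H : ∀ i, t.1 i ≠ 0 → g i = h i) :
    e.join (t, g) = e.join (t, h) := by
  ext i
  rw [join_apply, join_apply]
  by_cases ht : t.1 i = 0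
  · simp [ht]
  · simp only [H i ht]

/-- Commutativity of the scalars turns the right action on `EG` into the left action on the sphere.
-/
theorem join_mul_right (t : InfiniteSimplex) (g : ℕ → G) (c : G) (i : ℕ) :
    e.join (t, fun i => g i * c) i = e.toHom c * e.join (t, g) i := by
  simp only [join_apply, map_mul, mul_comm _ (e.toHom c), mul_smul_comm]

theorem toSphere_eq_smul {x y : ℕ →₀ 𝕜} (hx : x ≠ 0) (hy : y ≠ 0) {c : G}
    (h : ∀ i, x i = e.toHom c * y i) : toSphere x hx = c • toSphere y hy := by
  refine Subtype.ext (Finsupp.ext fun i => ?_)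
  have hn : ∀ i, ‖x i‖ = ‖y i‖ := fun i => by rw [h, norm_mul, e.norm_eq_one, one_mul]
  rw [e.smul_apply, toSphere_apply, toSphere_apply, finsupp_sum_norm_congr hn, h, mul_smul_comm]

/-- The coordinates in `BG` of a point of the sphere. -/
def coords (x : InfiniteSphere 𝕜) : InfiniteSimplex × (ℕ → G) :=
  (sphereToSimplex x, fun i => e.phase (x.1 i))

theorem coords_fst_ne_zero {x : InfiniteSphere 𝕜} {i : ℕ} (h : (e.coords x).1.1 i ≠ 0) :
    x.1 i ≠ 0 := fun hi => h (sphereToSimplex_apply_of_eq_zero hi)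

theorem mk_coords_smul (c : G) (x : InfiniteSphere 𝕜) :
    BG.mk (e.coords (c • x)) = BG.mk (e.coords x) := by
  rw [← BG.mk_mul_right (e.coords x).1 _ c, coords,
    sphereToSimplex_congr (e.norm_smul_apply c x)]
  refine BG.mk_eq_mk fun i hi => ?_
  rw [e.smul_apply, e.phase_mul _ (e.coords_fst_ne_zero hi)]
  rfl

theorem join_coords_apply (x : InfiniteSphere 𝕜) (i : ℕ) :
    e.join (e.coords x) i = ((sphereToSimplex x).1 i * ‖x.1 i‖⁻¹) • x.1 i := by
  by_cases hx : x.1 i = 0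
  · rw [join_apply, coords, hx, sphereToSimplex_apply_of_eq_zero hx, zero_smul, smul_zero]
  · rw [join_apply, coords, e.toHom_phase hx, smul_smul]

theorem join_coords_smul (c : G) (x : InfiniteSphere 𝕜) (i : ℕ) :
    e.join (e.coords (c • x)) i = e.toHom c * e.join (e.coords x) i := by
  rw [join_coords_apply, join_coords_apply, e.norm_smul_apply,
    sphereToSimplex_congr (e.norm_smul_apply c x), e.smul_apply, mul_smul_comm]

end

/-! ### Smoothness of the coordinates in `BG` -/

section Smoothness

variable {n : ℕ} {G 𝕜 : Type} [RCLike 𝕜] [CommGroup G] [DiffeologicalSpace G]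
  [MulAction G (InfiniteSphere 𝕜)] (e : UnitScalars G 𝕜)

theorem isPlot_phase {p : EuclideanSpace ℝ (Fin n) → 𝕜} (hp : ContDiff ℝ ∞ p)
    (h0 : ∀ x, p x ≠ 0) : IsPlot fun x => e.phase (p x) := by
  simp only [e.isPlot_iff, e.toHom_phase (h0 _)]
  exact ((hp.norm ℝ h0).inv fun x => norm_ne_zero_iff.2 (h0 x)).smul hp

variable [DiffeologicalSpace 𝕜] [IsContDiffCompatible 𝕜]

theorem isPlot_join {p : EuclideanSpace ℝ (Fin n) → InfiniteSimplex × (ℕ → G)}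
    (hp : IsPlot p) : IsPlot fun x => e.join (p x) := by
  have h := (isPlot_finsupp_iff (p := fun x => (p x).1.1)).1 hp.1
  refine isPlot_finsupp_iff.2 ⟨fun i => (h.1 i).smul (e.isPlot_iff.1 (hp.2 i)), fun x => ?_⟩
  obtain ⟨N, hN⟩ := h.2 x
  exact ⟨N, hN.mono fun y hy i hi => by rw [join_apply, hy i hi, zero_smul]⟩

/-- The phases of the coordinates need not be smooth where a coordinate vanishes, but they can be
replaced by smooth functions there. -/
theorem exists_isPlot_eventually_coords {p : EuclideanSpace ℝ (Fin n) → InfiniteSphere 𝕜}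
    (hp : IsPlot p) (x : EuclideanSpace ℝ (Fin n)) :
    ∃ g : EuclideanSpace ℝ (Fin n) → ℕ → G, IsPlot (fun y => (sphereToSimplex (p y), g y)) ∧
      ∀ᶠ y in 𝓝 x, ∀ i, (sphereToSimplex (p y)).1 i ≠ 0 → e.phase ((p y).1 i) = g y i := by
  classical
  have h := (isPlot_finsupp_iff (p := fun y => (p y).1)).1 hp
  have key : ∀ i, ∃ g : EuclideanSpace ℝ (Fin n) → G, IsPlot g ∧
      ∀ᶠ y in 𝓝 x, (sphereToSimplex (p y)).1 i ≠ 0 → e.phase ((p y).1 i) = g y := by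
    intro i
    by_cases hi : (p x).1 i = 0
    · exact ⟨fun _ => 1, isPlot_const,
        (eventually_sphereToSimplex_apply_eq_zero hp hi).mono fun y hy hy' => absurd hy hy'⟩
    -- Precomposing with `f` keeps the `i`-th coordinate away from `0` everywhere, giving a globally
    -- defined smooth phase that is unchanged near `x`.
    · obtain ⟨f, hfu, hf, hfx⟩ := exists_smooth_eventually_id
        ((h.1 i).continuous.isOpen_preimage _ isOpen_compl_singleton) (x := x) hi
      exact ⟨_, e.isPlot_phase ((h.1 i).comp hf) hfu,
        hfx.mono fun y hy _ => by rw [Function.comp_apply, hy]⟩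
  choose g hg hgx using key
  obtain ⟨N, hN⟩ := h.2 x
  refine ⟨fun y i => g i y, ⟨isPlot_sphereToSimplex hp, hg⟩, ?_⟩
  -- Only the indices up to `N` matter near `x`, so finitely many neighbourhoods are intersected.
  filter_upwards [hN, (Finset.eventually_all (Finset.range (N + 1))).2 fun i _ => hgx i]
    with y h1 h2 i hi
  refine h2 i (Finset.mem_range.2 ?_) hi
  by_contra hNi
  exact hi (sphereToSimplex_apply_of_eq_zero (h1 i (by omega)))

theorem dSmooth_mk_coords : DSmooth fun x => BG.mk (e.coords x) := fun _ _ hp =>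
  isPlot_of_eventuallyEq fun x => by
    obtain ⟨g, hg, hgx⟩ := e.exists_isPlot_eventually_coords hp x
    exact ⟨_, BG.dSmooth_mk _ _ hg, hgx.mono fun y hy => BG.mk_eq_mk hy⟩

theorem dSmooth_join_coords : DSmooth fun x => e.join (e.coords x) := fun _ _ hp =>
  isPlot_of_eventuallyEq fun x => by
    obtain ⟨g, hg, hgx⟩ := e.exists_isPlot_eventually_coords hp x
    exact ⟨_, e.isPlot_join hg, hgx.mono fun y hy => e.join_congr hy⟩

end Smoothness

/-! ### The two homotopies and the equivalence -/

section Homotopy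

theorem contDiff_smoothTransition_comp {n : ℕ} {s : EuclideanSpace ℝ (Fin n) → ℝ}
    (hs : IsPlot s) : ContDiff ℝ ∞ fun x => Real.smoothTransition (s x) :=
  Real.smoothTransition.contDiff.comp (IsContDiffCompatible.isPlot_iff.1 hs)

/-- The smoothSegment from `a` to `b`, extended to all real parameters. -/
def smoothSegment {V : Type*} [AddCommGroup V] [Module ℝ V] (a b : V) (s : ℝ) : V :=
  (1 - Real.smoothTransition s) • a + Real.smoothTransition s • b

variable {V : Type*} [AddCommGroup V] [Module ℝ V]

theorem smoothSegment_zero (a b : V) : smoothSegment a b 0 = a := by simp [smoothSegment]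

theorem smoothSegment_one (a b : V) : smoothSegment a b 1 = b := by simp [smoothSegment]

theorem isPlot_smoothSegment {n : ℕ} {V : Type*} [NormedAddCommGroup V] [NormedSpace ℝ V]
    [DiffeologicalSpace V] [IsContDiffCompatible V] {p q : EuclideanSpace ℝ (Fin n) → ℕ →₀ V}
    {s : EuclideanSpace ℝ (Fin n) → ℝ} (hp : IsPlot p) (hq : IsPlot q) (hs : IsPlot s) :
    IsPlot fun x => smoothSegment (p x) (q x) (s x) :=
  have h := contDiff_smoothTransition_comp hs
  isPlot_finsupp_add (isPlot_finsupp_smul (contDiff_const.sub h) hp) (isPlot_finsupp_smul h hq)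

/-- The parameter runs over all of `ℝ`; positivity survives because `Real.smoothTransition` takes
values in `[0, 1]`. -/
theorem smoothSegment_coeff_pos {a b : ℝ} (ha : 0 < a) (hb : 0 < b) (s : ℝ) : 0 < smoothSegment a b s := by
  have h0 := Real.smoothTransition.nonneg s
  have h1 := Real.smoothTransition.le_one s
  rcases h0.eq_or_lt with h | h
  · simpa [smoothSegment, ← h] using ha
  · exact add_pos_of_nonneg_of_pos (mul_nonneg (sub_nonneg.2 h1) ha.le) (mul_pos h hb)

theorem smoothSegment_nonneg {a b : ℝ} (ha : 0 ≤ a) (hb : 0 ≤ b) (s : ℝ) : 0 ≤ smoothSegment a b s :=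
  add_nonneg (mul_nonneg (sub_nonneg.2 (Real.smoothTransition.le_one s)) ha)
    (mul_nonneg (Real.smoothTransition.nonneg s) hb)

theorem smoothSegment_finsupp_apply {V : Type*} [AddCommGroup V] [Module ℝ V] (a b : ℕ →₀ V) (s : ℝ)
    (i : ℕ) : smoothSegment a b s i = smoothSegment (a i) (b i) s := rfl

variable {G 𝕜 : Type} [RCLike 𝕜] [CommGroup G] [DiffeologicalSpace G]
  [MulAction G (InfiniteSphere 𝕜)] (e : UnitScalars G 𝕜)

/-- At an index of nonzero weight, the whole segment consists of positive multiples of `x i`. -/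
theorem smoothSegment_join_coords_ne_zero (x : InfiniteSphere 𝕜) (s : ℝ) :
    smoothSegment (e.join (e.coords x)) x.1 s ≠ 0 := by
  obtain ⟨i, hi⟩ := Finsupp.ne_iff.1 (e.coords x).1.ne_zero
  have hx := e.coords_fst_ne_zero hi
  refine Finsupp.ne_iff.2 ⟨i, ?_⟩
  have h1 : 0 < (sphereToSimplex x).1 i * ‖x.1 i‖⁻¹ :=
    mul_pos (lt_of_le_of_ne ((sphereToSimplex x).2.2 i) (Ne.symm hi))
      (inv_pos.2 (norm_pos_iff.2 hx))
  have h2 := smoothSegment_coeff_pos h1 one_pos s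
  have h3 : smoothSegment (e.join (e.coords x)) x.1 s i =
      smoothSegment ((sphereToSimplex x).1 i * ‖x.1 i‖⁻¹) 1 s • x.1 i := by
    rw [smoothSegment_finsupp_apply, join_coords_apply]
    simp only [smoothSegment, add_smul, smul_eq_mul, mul_smul, one_smul]
  rw [h3]
  exact smul_ne_zero h2.ne' hx

theorem smoothSegment_simplex_ne_zero (t u : InfiniteSimplex) (h : ∀ i, t.1 i ≠ 0 → u.1 i ≠ 0) (s : ℝ) :
    smoothSegment t.1 u.1 s ≠ 0 := by
  obtain ⟨i, hi⟩ := Finsupp.ne_iff.1 t.ne_zero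
  exact Finsupp.ne_iff.2 ⟨i, (smoothSegment_coeff_pos (lt_of_le_of_ne (t.2.2 i) (Ne.symm hi))
    (lt_of_le_of_ne (u.2.2 i) (Ne.symm (h i hi))) s).ne'⟩

theorem smoothSegment_simplex_nonneg (t u : InfiniteSimplex) (s : ℝ) (i : ℕ) :
    0 ≤ smoothSegment t.1 u.1 s i := smoothSegment_nonneg (t.2.2 i) (u.2.2 i) s

/-- The unit vector with coordinates proportional to `t i * g i`. -/
def joinSphere (a : InfiniteSimplex × (ℕ → G)) : InfiniteSphere 𝕜 :=
  toSphere (e.join a) (e.join_ne_zero a)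

theorem joinSphere_congr {t : InfiniteSimplex} {g h : ℕ → G} (H : ∀ i, t.1 i ≠ 0 → g i = h i) :
    e.joinSphere (t, g) = e.joinSphere (t, h) := by
  simp only [joinSphere, e.join_congr H]

theorem joinSphere_mul_right (t : InfiniteSimplex) (g : ℕ → G) (c : G) :
    e.joinSphere (t, fun i => g i * c) = c • e.joinSphere (t, g) :=
  e.toSphere_eq_smul _ _ (e.join_mul_right t g c)

theorem phase_joinSphere {a : InfiniteSimplex × (ℕ → G)} {i : ℕ} (hi : a.1.1 i ≠ 0) :
    e.phase ((e.joinSphere a).1 i) = a.2 i := by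
  rw [joinSphere, toSphere_apply, join_apply, smul_smul]
  exact e.phase_smul_toHom _ (mul_pos
    (inv_pos.2 (Real.sqrt_pos.2 (finsupp_sum_norm_sq_pos (e.join_ne_zero a))))
    (lt_of_le_of_ne (a.1.2.2 i) (Ne.symm hi)))

theorem sphereToSimplex_joinSphere {a : InfiniteSimplex × (ℕ → G)} {i : ℕ}
    (hi : (sphereToSimplex (e.joinSphere a)).1 i ≠ 0) : a.1.1 i ≠ 0 := fun h =>
  hi (sphereToSimplex_apply_of_eq_zero (by
    rw [joinSphere, toSphere_apply, join_apply, h, zero_smul, smul_zero]))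

/-- The weights of the homotopy on `BG`. -/
def simplexHomotopy (a : InfiniteSimplex × (ℕ → G)) (s : ℝ) : InfiniteSimplex :=
  toSimplex (smoothSegment (sphereToSimplex (e.joinSphere a)).1 a.1.1 s)
    (smoothSegment_simplex_nonneg _ _ s)
    (smoothSegment_simplex_ne_zero _ _ (fun _ => e.sphereToSimplex_joinSphere) s)

theorem simplexHomotopy_zero (a : InfiniteSimplex × (ℕ → G)) :
    e.simplexHomotopy a 0 = sphereToSimplex (e.joinSphere a) := by
  simp only [simplexHomotopy, smoothSegment_zero, toSimplex_self]

theorem simplexHomotopy_one (a : InfiniteSimplex × (ℕ → G)) : e.simplexHomotopy a 1 = a.1 := by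
  simp only [simplexHomotopy, smoothSegment_one, toSimplex_self]

/-- The homotopy never leaves the support of `t`, so the ambiguity of `g` off that support does no
harm. -/
theorem fst_ne_zero_of_simplexHomotopy {a : InfiniteSimplex × (ℕ → G)} {s : ℝ} {i : ℕ}
    (hi : (e.simplexHomotopy a s).1 i ≠ 0) : a.1.1 i ≠ 0 := fun h => by
  refine toSimplex_apply_ne_zero_iff.1 hi ?_
  have h' : (sphereToSimplex (e.joinSphere a)).1 i = 0 := by
    by_contra h'
    exact e.sphereToSimplex_joinSphere h' h
  rw [smoothSegment_finsupp_apply, h, h']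
  simp [smoothSegment]

theorem simplexHomotopy_congr {a b : InfiniteSimplex × (ℕ → G)} {s : ℝ} (h : a.1 = b.1)
    (h' : ∀ i, ‖(e.joinSphere a).1 i‖ = ‖(e.joinSphere b).1 i‖) :
    e.simplexHomotopy a s = e.simplexHomotopy b s := by
  simp only [simplexHomotopy, sphereToSimplex_congr h', h]

/-- The homotopy on the sphere. -/
def sphereHomotopy (x : InfiniteSphere 𝕜) (s : ℝ) : InfiniteSphere 𝕜 :=
  toSphere (smoothSegment (e.join (e.coords x)) x.1 s) (e.smoothSegment_join_coords_ne_zero x s)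

theorem sphereHomotopy_zero (x : InfiniteSphere 𝕜) :
    e.sphereHomotopy x 0 = e.joinSphere (e.coords x) := by
  simp only [sphereHomotopy, smoothSegment_zero, joinSphere]

theorem sphereHomotopy_one (x : InfiniteSphere 𝕜) : e.sphereHomotopy x 1 = x := by
  simp only [sphereHomotopy, smoothSegment_one, toSphere_self]

theorem sphereHomotopy_smul (c : G) (x : InfiniteSphere 𝕜) (s : ℝ) :
    e.sphereHomotopy (c • x) s = c • e.sphereHomotopy x s :=
  e.toSphere_eq_smul _ _ fun i => by
    rw [smoothSegment_finsupp_apply, smoothSegment_finsupp_apply, join_coords_smul, e.smul_apply]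
    simp only [smoothSegment, mul_add, mul_smul_comm]

variable [DiffeologicalSpace 𝕜] [IsContDiffCompatible 𝕜]

theorem isPlot_joinSphere {n : ℕ} {p : EuclideanSpace ℝ (Fin n) → InfiniteSimplex × (ℕ → G)}
    (hp : IsPlot p) : IsPlot fun x => e.joinSphere (p x) :=
  isPlot_toSphere (e.isPlot_join hp) _

theorem isPlot_simplexHomotopy {n : ℕ}
    {p : EuclideanSpace ℝ (Fin n) → InfiniteSimplex × (ℕ → G)}
    {s : EuclideanSpace ℝ (Fin n) → ℝ} (hp : IsPlot p) (hs : IsPlot s) :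
    IsPlot fun x => e.simplexHomotopy (p x) (s x) :=
  isPlot_toSimplex (isPlot_smoothSegment (isPlot_sphereToSimplex (e.isPlot_joinSphere hp)) hp.1 hs) _ _

theorem isPlot_sphereHomotopy {n : ℕ} {p : EuclideanSpace ℝ (Fin n) → InfiniteSphere 𝕜}
    {s : EuclideanSpace ℝ (Fin n) → ℝ} (hp : IsPlot p) (hs : IsPlot s) :
    IsPlot fun x => e.sphereHomotopy (p x) (s x) :=
  isPlot_toSphere (isPlot_smoothSegment (e.dSmooth_join_coords _ _ hp) hp hs) _

/-- `BG` is smoothly homotopy equivalent to the orbit space of the sphere. -/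
theorem smoothlyHomotopyEquivalent (e : UnitScalars G 𝕜) :
    SmoothlyHomotopyEquivalent (BG G)
      (Quotient (MulAction.orbitRel G (InfiniteSphere 𝕜))) := by
  let π : InfiniteSphere 𝕜 → Quotient (MulAction.orbitRel G (InfiniteSphere 𝕜)) := Quotient.mk _
  have hπ : DSmooth π := dSmooth_quotientMk _
  have hπc (c : G) (x : InfiniteSphere 𝕜) : π (c • x) = π x :=
    Quotient.sound (s := MulAction.orbitRel G (InfiniteSphere 𝕜)) ⟨c, rfl⟩
  let f : BG G → Quotient (MulAction.orbitRel G (InfiniteSphere 𝕜)) :=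
    BG.lift (fun a => π (e.joinSphere a)) (fun _ _ _ H => by rw [e.joinSphere_congr H])
      fun t g c => by rw [e.joinSphere_mul_right, hπc]
  let g : Quotient (MulAction.orbitRel G (InfiniteSphere 𝕜)) → BG G :=
    Quotient.lift (fun x => BG.mk (e.coords x)) fun x y hxy => by
      obtain ⟨c, rfl⟩ := hxy
      exact e.mk_coords_smul c y
  let F (s : ℝ) : BG G → BG G :=
    BG.lift (fun a => BG.mk (e.simplexHomotopy a s, a.2))
      (fun t g g' H => by
        rw [e.simplexHomotopy_congr (a := (t, g)) (b := (t, g')) rfl fun i => by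
          rw [e.joinSphere_congr H]]
        exact BG.mk_eq_mk fun i hi => H i (e.fst_ne_zero_of_simplexHomotopy hi))
      fun t g c => by
        rw [e.simplexHomotopy_congr (a := (t, fun i => g i * c)) (b := (t, g)) rfl fun i => by
          rw [e.joinSphere_mul_right, e.norm_smul_apply]]
        exact BG.mk_mul_right (e.simplexHomotopy (t, g) s) g c
  let K (s : ℝ) : Quotient (MulAction.orbitRel G (InfiniteSphere 𝕜)) →
      Quotient (MulAction.orbitRel G (InfiniteSphere 𝕜)) :=
    Quotient.lift (fun x => π (e.sphereHomotopy x s)) fun x y hxy => by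
      obtain ⟨c, rfl⟩ := hxy
      exact (congrArg π (e.sphereHomotopy_smul c y s)).trans (hπc _ _)
  refine ⟨f, g, BG.dSmooth_of_comp_mk fun _ _ hp => hπ _ _ (e.isPlot_joinSphere hp),
    dSmooth_of_comp_quotientMk e.dSmooth_mk_coords, ⟨fun x => F x.2 x.1, ?_, ?_, ?_⟩,
    ⟨fun x => K x.2 x.1, ?_, ?_, ?_⟩⟩
  · exact BG.dSmooth_of_comp_mk_prod fun _ p hp => BG.dSmooth_mk _ _
      ⟨e.isPlot_simplexHomotopy hp.1 hp.2, hp.1.2⟩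
  · intro x
    obtain ⟨a, rfl⟩ := BG.mk_surjective x
    change BG.mk (e.simplexHomotopy a 0, a.2) = BG.mk (e.coords (e.joinSphere a))
    rw [e.simplexHomotopy_zero]
    -- The round trip through the sphere recovers `g i` wherever the new weight is nonzero.
    exact BG.mk_eq_mk fun i hi => (e.phase_joinSphere (e.sphereToSimplex_joinSphere hi)).symm
  · intro x
    obtain ⟨a, rfl⟩ := BG.mk_surjective x
    change BG.mk (e.simplexHomotopy a 1, a.2) = BG.mk a
    rw [e.simplexHomotopy_one]
  · exact dSmooth_of_comp_quotientMk_prod fun _ p hp => hπ _ _ (e.isPlot_sphereHomotopy hp.1 hp.2)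
  · intro x
    induction x using Quotient.inductionOn with
    | h x => exact congrArg π (e.sphereHomotopy_zero x)
  · intro x
    induction x using Quotient.inductionOn with
    | h x => exact congrArg π (e.sphereHomotopy_one x)

end Homotopy

/-- The group `{±1}` as the group of real numbers of norm `1`. -/
def intUnits : UnitScalars ℤˣ ℝ where
  toHom := (Int.castRingHom ℝ : ℤ →* ℝ).comp (Units.coeHom ℤ)
  norm_eq_one g := by rcases Int.units_eq_one_or g with rfl | rfl <;> simp
  exists_eq a ha := by
    rcases eq_or_eq_neg_of_abs_eq ha with rfl | rfl
    · exact ⟨1, by simp⟩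
    · exact ⟨-1, by simp⟩
  injective := Int.cast_injective.comp Units.val_injective
  isPlot_iff {n p} := by
    refine ⟨fun hp => ?_, fun hp => ?_⟩
    · refine contDiff_iff_contDiffAt.2 fun x => (contDiffAt_const (c :=
        ((p x : ℤ) : ℝ))).congr_of_eventuallyEq ((IsLocallyConstant.eventually_eq (f := p) hp x).mono fun y hy => ?_)
      simp only [hy]
      rfl
    · refine (IsLocallyConstant.iff_eventually_eq p).2 fun x => ?_
      -- The two values `1` and `-1` are at distance `2`, so values at distance less than `1`
      -- coincide.
      filter_upwards [Metric.continuousAt_iff'.1 hp.continuous.continuousAt 1 one_pos] with y hy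
      rcases Int.units_eq_one_or (p x) with h1 | h1 <;>
        rcases Int.units_eq_one_or (p y) with h2 | h2 <;>
        first | exact h2.trans h1.symm | (exfalso; simp [h1, h2, Real.dist_eq] at hy; norm_num at hy)
  smul_apply g x i := by
    change g • x.1 i = _
    rw [Units.smul_def, zsmul_eq_mul]
    rfl

/-- The circle group as the group of complex numbers of norm `1`. -/
def circle : UnitScalars Circle ℂ where
  toHom := Circle.coeHom
  norm_eq_one := Circle.norm_coe
  exists_eq a ha := ⟨⟨a, mem_sphere_zero_iff_norm.2 ha⟩, rfl⟩
  injective := Circle.coe_injective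
  isPlot_iff := isPlot_circle_iff
  smul_apply _ _ _ := rfl

end UnitScalars

end SmoothClassifying

end

theorem mainTheorem12 :
    SmoothClassifying.SmoothlyHomotopyEquivalent
      (SmoothClassifying.BG ℤˣ) SmoothClassifying.InfiniteRealProjectiveSpace ∧
    SmoothClassifying.SmoothlyHomotopyEquivalent
      (SmoothClassifying.BG Circle) SmoothClassifying.InfiniteComplexProjectiveSpace := by
  have : IsContDiffCompatible ℂ := ⟨Iff.rfl⟩
  have : IsContDiffCompatible ℝ := ⟨Iff.rfl⟩
  exact ⟨SmoothClassifying.UnitScalars.intUnits.smoothlyHomotopyEquivalent,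
    SmoothClassifying.UnitScalars.circle.smoothlyHomotopyEquivalent⟩
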